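/- Let $\varphi(q)=\prod_{j\ge 1}(1-q^j)$ be Euler's product. For a positive integer $m$ and $k=(k_1,\dots,k_{4m-1})\in\mathbb Z^{4m-1}$ put $$\kappa(k)=\sum_{i=1}^{4m-1}k_i^2-\sum_{i=1}^{4m-2}k_ik_{i+1},$$ $$\mathrm{lin}(k)=(2m-1)k_1-k_2-\cdots-k_{3m-1}+(4m-2)k_{3m}-k_{3m+1}-\cdots-k_{4m-1}.$$ Then for every positive integer $m$ all the exponents $(4m-1)\kappa(k)+\mathrm{lin}(k)$ are non-negative, and $$\sum_{k\in\mathbb Z^{4m-1}}q^{(4m-1)\kappa(k)+\mathrm{lin}(k)}=\frac{\varphi(q^{4m-1})^{4m-1}\,\varphi(q^{2m})^2}{\varphi(q)\,\varphi(q^m)},$$ both as an identity of formal power series in $\mathbb C[[q]]$ (with coefficientwise convergence) and as an identity of complex numbers for every $q\in\mathbb C$ with $|q|<1$ (with absolute convergence). -/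

import Mathlib

open scoped PowerSeries.WithPiTopology

/-- Euler's product `φ(x) = ∏_{j ≥ 1} (1 - x ^ j)` in a topological commutative ring. It is used for
complex numbers `x` with `‖x‖ < 1` and for the formal power series `x = X ^ a` with `1 ≤ a`; the
product converges in both cases. -/
noncomputable def eulerPhi {R : Type*} [CommRing R] [TopologicalSpace R] (x : R) : R :=
  ∏' j : ℕ, (1 - x ^ (j + 1))

/-- The quadratic form `κ(k_1, …, k_l) = k_1² + ⋯ + k_l² - k_1 k_2 - ⋯ - k_{l-1} k_l`.
The variable `k_i` is `k ⟨i - 1, _⟩`. -/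
def kappa {l : ℕ} (k : Fin l → ℤ) : ℤ :=
  ∑ i : Fin l, k i ^ 2 -
    ∑ i : Fin (l - 1), k ⟨i.val, by omega⟩ * k ⟨i.val + 1, by omega⟩

/-- The coefficient of `k_{i+1}` in `lin`: it is `2m - 1` for `k_1`, `4m - 2` for `k_{3m}`
and `-1` for every other variable. -/
def linCoeff (m : ℕ) (i : Fin (4 * m - 1)) : ℤ :=
  if i.val + 1 = 1 then 2 * (m : ℤ) - 1
  else if i.val + 1 = 3 * m then 4 * (m : ℤ) - 2
  else -1

/-- The linear form `(2m-1) k_1 - k_2 - ⋯ - k_{3m-1} + (4m-2) k_{3m} - k_{3m+1} - ⋯ - k_{4m-1}`. -/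
def lin (m : ℕ) (k : Fin (4 * m - 1) → ℤ) : ℤ :=
  ∑ i : Fin (4 * m - 1), linCoeff m i * k i

/-- The exponent `(4m-1) κ(k) + lin(k)`. -/
def gaussExponent (m : ℕ) (k : Fin (4 * m - 1) → ℤ) : ℤ :=
  (4 * (m : ℤ) - 1) * kappa k + lin m k

/-! Put `l = 4m - 1`. Passing to the differences `y_i = k_{i+1} - k_i` and rotating the indices by
`m` turns the exponent into `residueForm l y - tri s + m(2s² - s)`, where `s` is the coordinate sum
of `y` (`exists_gaussExponent_equiv`). The affine rotation identifies the slice of sum `s` with the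
slice of sum zero and changes `residueForm` by exactly `tri s`. Hence the exponent separates as
`m(2s² - s)` plus `residueForm` on the sum-zero lattice; non-negativity is then visible, and the
series is a product of two.

The sum over `s` is Gauss's identity at `q^m` (`hasSum_gauss`). For the other factor, the series of
`residueForm` over all of `ℤ^l` is a product of `l` Jacobi triple products, but by the same slicing
it is also the sum-zero series times the series of `tri`; dividing leaves `φ(q^l)^l / φ(q)`
(`hasSum_residueForm_sum_zero`).

The formal identity follows from the analytic one, because a power series is determined by its sums
on the unit disc (`eq_of_hasEval`). -/

open Filter Topology

/-! ### Triangular numbers and q-Pochhammer symbols -/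

/-- The triangular number `y (y - 1) / 2` attached to an integer. -/
def tri (y : ℤ) : ℤ := y * (y - 1) / 2

theorem two_mul_tri (y : ℤ) : 2 * tri y = y * (y - 1) := by
  unfold tri
  refine Int.mul_ediv_cancel' ?_
  have := (Int.even_mul_pred_self y)
  exact this.two_dvd

theorem tri_add_one (y : ℤ) : tri (y + 1) = tri y + y := by
  have h1 := two_mul_tri (y + 1)
  have h2 := two_mul_tri y
  linarith

theorem tri_zero : tri 0 = 0 := rfl

theorem tri_nonneg (y : ℤ) : 0 ≤ tri y := by
  have h := two_mul_tri y
  rcases le_or_gt y 0 with h0 | h0 <;> nlinarith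

/-- The finite `q`-Pochhammer symbol `(1 - p) ⋯ (1 - p ^ n)`. -/
noncomputable def qPoch (p : ℂ) (n : ℕ) : ℂ := ∏ j ∈ Finset.range n, (1 - p ^ (j + 1))

/-- The reciprocal of `qPoch`, extended by zero to negative integers. -/
noncomputable def qPochInv (p : ℂ) (n : ℤ) : ℂ := if n < 0 then 0 else (qPoch p n.toNat)⁻¹

theorem pow_ne_one_of_norm_lt_one {p : ℂ} (hp : ‖p‖ < 1) {n : ℕ} (hn : n ≠ 0) : p ^ n ≠ 1 := by
  intro h
  have := congrArg norm h
  rw [norm_pow, norm_one] at this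
  exact absurd this (pow_lt_one₀ (norm_nonneg _) hp hn).ne

theorem qPoch_ne_zero {p : ℂ} (hp : ‖p‖ < 1) (n : ℕ) : qPoch p n ≠ 0 := by
  refine Finset.prod_ne_zero_iff.2 fun j _ => ?_
  exact sub_ne_zero.2 (pow_ne_one_of_norm_lt_one hp (Nat.succ_ne_zero j)).symm

/-- The extension by zero makes the recurrence valid at every integer: at `n = 0` the factor `1 - p
^ 0` vanishes. Boundary cases thus disappear from the finite triple product. -/
theorem qPochInv_pred {p : ℂ} (hp : ‖p‖ < 1) (n : ℤ) :
    qPochInv p (n - 1) = (1 - p ^ n) * qPochInv p n := by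
  rcases lt_trichotomy n 0 with h | rfl | h
  · rw [qPochInv, qPochInv, if_pos (by omega), if_pos h, mul_zero]
  · simp [qPochInv]
  · obtain ⟨k, rfl⟩ : ∃ k : ℕ, n = (k + 1 : ℕ) := ⟨n.toNat - 1, by omega⟩
    have h1 : ((k + 1 : ℕ) : ℤ) - 1 = (k : ℤ) := by push_cast; ring
    rw [h1, qPochInv, qPochInv, if_neg (by omega), if_neg (by omega), Int.toNat_natCast,
      Int.toNat_natCast, zpow_natCast]
    have h2 := qPoch_ne_zero hp k
    have h3 : (1 - p ^ (k + 1)) ≠ 0 :=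
      sub_ne_zero.2 (pow_ne_one_of_norm_lt_one hp (Nat.succ_ne_zero k)).symm
    rw [qPoch, qPoch, Finset.prod_range_succ]
    rw [qPoch] at h2
    field_simp

theorem summable_norm_mul_pow {p : ℂ} (hp : ‖p‖ < 1) (w : ℂ) :
    Summable fun j : ℕ => ‖w * p ^ j‖ := by
  simp_rw [norm_mul, norm_pow]
  exact (summable_geometric_of_lt_one (norm_nonneg _) hp).mul_left _

theorem multipliable_one_add_mul_pow {p : ℂ} (hp : ‖p‖ < 1) (w : ℂ) :
    Multipliable fun j : ℕ => 1 + w * p ^ j :=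
  multipliable_one_add_of_summable (summable_norm_mul_pow hp w)

theorem multipliable_one_sub_pow_succ {p : ℂ} (hp : ‖p‖ < 1) :
    Multipliable fun j : ℕ => 1 - p ^ (j + 1) := by
  convert multipliable_one_add_mul_pow hp (-p) using 2 with j
  ring

theorem tendsto_qPoch {p : ℂ} (hp : ‖p‖ < 1) :
    Tendsto (qPoch p) atTop (𝓝 (eulerPhi p)) :=
  (multipliable_one_sub_pow_succ hp).hasProd.tendsto_prod_nat

theorem eulerPhi_ne_zero {p : ℂ} (hp : ‖p‖ < 1) : eulerPhi p ≠ 0 := by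
  have h := tprod_one_add_ne_zero_of_summable (f := fun j : ℕ => -p * p ^ j) (fun j => ?_)
    (summable_norm_mul_pow hp (-p))
  · convert h using 1
    unfold eulerPhi
    exact tprod_congr fun j => by ring
  · have := sub_ne_zero.2 (pow_ne_one_of_norm_lt_one hp (Nat.succ_ne_zero j)).symm
    convert this using 1
    rw [pow_succ]; ring

theorem tendsto_qPochInv {p : ℂ} (hp : ‖p‖ < 1) :
    Tendsto (qPochInv p) atTop (𝓝 (eulerPhi p)⁻¹) := by
  have h1 : Tendsto (fun n : ℤ => (qPoch p n.toNat)⁻¹) atTop (𝓝 (eulerPhi p)⁻¹) := by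
    refine ((tendsto_qPoch hp).inv₀ (eulerPhi_ne_zero hp)).comp ?_
    refine tendsto_atTop.2 fun b => ?_
    filter_upwards [eventually_ge_atTop (b : ℤ)] with n hn
    omega
  refine h1.congr' ?_
  filter_upwards [eventually_ge_atTop 0] with n hn
  rw [qPochInv, if_neg (by omega)]

theorem exists_norm_qPochInv_le {p : ℂ} (hp : ‖p‖ < 1) :
    ∃ M : ℝ, ∀ n, ‖qPochInv p n‖ ≤ M := by
  obtain ⟨M, hM⟩ := ((tendsto_qPoch hp).inv₀ (eulerPhi_ne_zero hp)).norm.bddAbove_range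
  refine ⟨max M 0, fun n => ?_⟩
  unfold qPochInv
  split_ifs
  · simp
  · exact le_max_of_le_left (hM ⟨n.toNat, rfl⟩)

theorem exists_norm_qPoch_le {p : ℂ} (hp : ‖p‖ < 1) :
    ∃ M : ℝ, ∀ n, ‖qPoch p n‖ ≤ M := by
  obtain ⟨M, hM⟩ := (tendsto_qPoch hp).norm.bddAbove_range
  exact ⟨M, fun n => hM ⟨n, rfl⟩⟩

/-! ### Jacobi's triple product -/

/-- The terms of the finite form of the triple product identity. -/
noncomputable def finiteThetaTerm (p w : ℂ) (N : ℕ) (y : ℤ) : ℂ :=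
  qPoch p (2 * N) * qPochInv p (N + y) * qPochInv p (N - y) * (p ^ tri y * w ^ y)

/-- This compares coefficients of powers of `w` when the finite product is multiplied by its next
factor `(1 + w p^N)(1 + p^(N+1)/w) = (1 + p^(2N+1)) + w p^N + p^(N+1)/w`. -/
theorem finiteThetaTerm_succ {p w : ℂ} (hp0 : p ≠ 0) (hp : ‖p‖ < 1) (hw : w ≠ 0) (N : ℕ) (y : ℤ) :
    finiteThetaTerm p w (N + 1) y = (1 + p ^ (2 * N + 1)) * finiteThetaTerm p w N y +
      w * p ^ N * finiteThetaTerm p w N (y - 1) +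
        p ^ (N + 1) * w⁻¹ * finiteThetaTerm p w N (y + 1) := by
  unfold finiteThetaTerm
  have e1 : qPoch p (2 * (N + 1)) =
      qPoch p (2 * N) * (1 - p ^ (2 * N + 1)) * (1 - p ^ (2 * N + 2)) := by
    rw [qPoch, qPoch, show 2 * (N + 1) = 2 * N + 1 + 1 by ring, Finset.prod_range_succ,
      Finset.prod_range_succ]
  have t1 : tri y = tri (y - 1) + (y - 1) := by
    have := tri_add_one (y - 1); rwa [sub_add_cancel] at this
  have t2 := tri_add_one y
  have r1 : qPochInv p (N + y) = (1 - p ^ ((N : ℤ) + 1 + y)) * qPochInv p ((N + 1 : ℕ) + y) := by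
    have := qPochInv_pred hp ((N : ℤ) + 1 + y)
    rw [show (N : ℤ) + 1 + y - 1 = N + y by ring] at this
    rw [this]; push_cast; rfl
  have r2 : qPochInv p (N - y) = (1 - p ^ ((N : ℤ) + 1 - y)) * qPochInv p ((N + 1 : ℕ) - y) := by
    have := qPochInv_pred hp ((N : ℤ) + 1 - y)
    rw [show (N : ℤ) + 1 - y - 1 = N - y by ring] at this
    rw [this]; push_cast; rfl
  have r3 : qPochInv p (N + (y - 1)) = (1 - p ^ ((N : ℤ) + y)) * qPochInv p (N + y) := by
    rw [← qPochInv_pred hp]; congr 1; ring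
  have r4 : qPochInv p (N - (y + 1)) = (1 - p ^ ((N : ℤ) - y)) * qPochInv p (N - y) := by
    rw [← qPochInv_pred hp]; congr 1; ring
  have r5 : qPochInv p (N - (y - 1)) = qPochInv p ((N + 1 : ℕ) - y) := by
    congr 1; push_cast; ring
  have r6 : qPochInv p (N + (y + 1)) = qPochInv p ((N + 1 : ℕ) + y) := by
    congr 1; push_cast; ring
  rw [r3, r4, r5, r6, r1, r2, e1, t2, t1]
  generalize qPochInv p ((N + 1 : ℕ) + y) = R
  generalize qPochInv p ((N + 1 : ℕ) - y) = S
  generalize qPoch p (2 * N) = Q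
  generalize tri (y - 1) = t
  have hy : p ^ y ≠ 0 := zpow_ne_zero _ hp0
  simp only [zpow_add₀ hp0, zpow_sub₀ hp0, zpow_add₀ hw, zpow_sub₀ hw, zpow_one, zpow_natCast,
    pow_add, pow_mul', pow_one]
  field_simp
  ring

theorem hasSum_finiteThetaTerm {p w : ℂ} (hp0 : p ≠ 0) (hp : ‖p‖ < 1) (hw : w ≠ 0) (N : ℕ) :
    HasSum (finiteThetaTerm p w N)
      (∏ k ∈ Finset.range N, ((1 + w * p ^ k) * (1 + p * w⁻¹ * p ^ k))) := by
  induction N with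
  | zero =>
    have : (∏ k ∈ Finset.range 0, ((1 + w * p ^ k) * (1 + p * w⁻¹ * p ^ k))) =
        finiteThetaTerm p w 0 0 := by
      simp [finiteThetaTerm, qPoch, qPochInv, tri]
    rw [this]
    refine hasSum_single _ fun y hy => ?_
    rcases lt_or_gt_of_ne hy with h | h
    · simp [finiteThetaTerm, qPochInv, h]
    · simp [finiteThetaTerm, qPochInv, h]
  | succ N ih =>
    have h1 := (Equiv.subRight (1 : ℤ)).hasSum_iff.2 ih
    have h2 := (Equiv.addRight (1 : ℤ)).hasSum_iff.2 ih
    have h := ((ih.mul_left (1 + p ^ (2 * N + 1))).add (h1.mul_left (w * p ^ N))).add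
      (h2.mul_left (p ^ (N + 1) * w⁻¹))
    rw [funext (finiteThetaTerm_succ hp0 hp hw N)]
    have hv (A : ℂ) : A * ((1 + w * p ^ N) * (1 + p * w⁻¹ * p ^ N)) =
        (1 + p ^ (2 * N + 1)) * A + w * p ^ N * A + p ^ (N + 1) * w⁻¹ * A := by
      field_simp
      ring
    rw [Finset.prod_range_succ, hv]
    exact h

theorem summable_theta {p w : ℂ} (hp0 : p ≠ 0) (hp : ‖p‖ < 1) (hw : w ≠ 0) :
    Summable fun y : ℤ => ‖p ^ tri y * w ^ y‖ := by
  have key : ∀ u : ℂ, u ≠ 0 → Summable fun n : ℕ => ‖p ^ tri n * u ^ n‖ := by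
    intro u hu
    have hu' : ∀ n : ℕ, ‖p ^ tri n * u ^ n‖ ≠ 0 := fun n =>
      norm_ne_zero_iff.2 (mul_ne_zero (zpow_ne_zero _ hp0) (pow_ne_zero _ hu))
    refine summable_of_ratio_test_tendsto_lt_one (l := 0) one_pos (Eventually.of_forall hu') ?_
    have : ∀ n : ℕ, ‖‖p ^ tri (n + 1 : ℕ) * u ^ (n + 1)‖‖ / ‖‖p ^ tri n * u ^ n‖‖ =
        ‖p‖ ^ n * ‖u‖ := by
      intro n
      rw [norm_norm, norm_norm, div_eq_iff (hu' n)]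
      push_cast
      rw [tri_add_one, zpow_add₀ hp0, zpow_natCast, pow_succ]
      simp only [norm_mul, norm_pow]
      ring
    simp_rw [this]
    simpa using (tendsto_pow_atTop_nhds_zero_of_lt_one (norm_nonneg p) hp).mul_const ‖u‖
  refine Summable.of_nat_of_neg ?_ ?_
  · simpa using key w hw
  -- Since `tri (-n) = tri n + n`, the negative half is the positive half with `w` replaced by `p /
  -- w`.
  · refine (key (p * w⁻¹) (mul_ne_zero hp0 (inv_ne_zero hw))).congr fun n => ?_
    have : tri (-(n : ℤ)) = tri n + n := by
      have h1 := two_mul_tri (-(n : ℤ))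
      have h2 := two_mul_tri n
      linarith
    rw [this, zpow_add₀ hp0, zpow_neg, mul_pow, inv_pow, zpow_natCast, zpow_natCast]
    congr 1
    ring

/-- **Jacobi's triple product identity.** -/
theorem hasSum_theta {p w : ℂ} (hp0 : p ≠ 0) (hp : ‖p‖ < 1) (hw : w ≠ 0) :
    HasSum (fun y : ℤ => p ^ tri y * w ^ y)
      (eulerPhi p * ((∏' k : ℕ, (1 + w * p ^ k)) * ∏' k : ℕ, (1 + p * w⁻¹ * p ^ k))) := by
  obtain ⟨M, hM⟩ := exists_norm_qPochInv_le hp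
  obtain ⟨M', hM'⟩ := exists_norm_qPoch_le hp
  have hM0 : 0 ≤ M := (norm_nonneg _).trans (hM 0)
  have hM'0 : 0 ≤ M' := (norm_nonneg _).trans (hM' 0)
  have hS := summable_theta hp0 hp hw
  -- Let `N → ∞` termwise: the Pochhammer factors tend to `φ · φ⁻¹ · φ⁻¹` and are uniformly bounded,
  -- so the theta series itself dominates.
  have hlim : Tendsto (fun N : ℕ => ∑' y, finiteThetaTerm p w N y) atTop
      (𝓝 (∑' y : ℤ, (eulerPhi p)⁻¹ * (p ^ tri y * w ^ y))) := by
    refine tendsto_tsum_of_dominated_convergence (hS.mul_left (M' * M * M)) (fun y => ?_)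
      (Eventually.of_forall fun N y => ?_)
    · have h1 : Tendsto (fun N : ℕ => qPoch p (2 * N)) atTop (𝓝 (eulerPhi p)) :=
        (tendsto_qPoch hp).comp (tendsto_id.const_mul_atTop' two_pos)
      have h2 : Tendsto (fun N : ℕ => qPochInv p (N + y)) atTop (𝓝 (eulerPhi p)⁻¹) :=
        (tendsto_qPochInv hp).comp (tendsto_atTop_add_const_right _ _ tendsto_natCast_atTop_atTop)
      have h3 : Tendsto (fun N : ℕ => qPochInv p (N - y)) atTop (𝓝 (eulerPhi p)⁻¹) := by
        simp_rw [sub_eq_add_neg]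
        exact (tendsto_qPochInv hp).comp
          (tendsto_atTop_add_const_right _ _ tendsto_natCast_atTop_atTop)
      have h := ((h1.mul h2).mul h3).mul_const (p ^ tri y * w ^ y)
      rwa [mul_inv_cancel₀ (eulerPhi_ne_zero hp), one_mul] at h
    · unfold finiteThetaTerm
      rw [norm_mul]
      refine mul_le_mul_of_nonneg_right ?_ (norm_nonneg _)
      rw [norm_mul, norm_mul]
      gcongr
      · exact hM' _
      · exact hM _
      · exact hM _
  have hprod := (((multipliable_one_add_mul_pow hp w).hasProd.mul
    (multipliable_one_add_mul_pow hp (p * w⁻¹)).hasProd)).tendsto_prod_nat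
  have huniq := tendsto_nhds_unique (hlim.congr fun N =>
    (hasSum_finiteThetaTerm hp0 hp hw N).tsum_eq) hprod
  rw [tsum_mul_left] at huniq
  rw [← huniq, mul_inv_cancel_left₀ (eulerPhi_ne_zero hp)]
  exact hS.of_norm.hasSum

/-- A product of absolutely convergent series, expanded as a series over tuples. -/
theorem hasSum_pi_prod {ι : Type*} (n : ℕ) (f : Fin n → ι → ℂ) (a : Fin n → ℂ)
    (hn : ∀ j, Summable fun x => ‖f j x‖) (hf : ∀ j, HasSum (f j) (a j)) :
    (Summable fun y : Fin n → ι => ‖∏ j, f j (y j)‖) ∧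
      HasSum (fun y : Fin n → ι => ∏ j, f j (y j)) (∏ j, a j) := by
  induction n with
  | zero => exact ⟨(hasSum_fintype _).summable, by simp⟩
  | succ n ih =>
    obtain ⟨h1, h2⟩ : (Summable fun y : Fin n → ι => ‖∏ j : Fin n, f j.succ (y j)‖) ∧
        HasSum (fun y : Fin n → ι => ∏ j : Fin n, f j.succ (y j)) (∏ j : Fin n, a j.succ) :=
      ih _ _ (fun j => hn j.succ) fun j => hf j.succ
    let e := Fin.consEquiv (fun _ : Fin (n + 1) => ι)
    have hs : Summable fun x : ι × (Fin n → ι) => ‖f 0 x.1 * ∏ j : Fin n, f j.succ (x.2 j)‖ :=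
      Summable.mul_norm (f := f 0) (g := fun y : Fin n → ι => ∏ j : Fin n, f j.succ (y j)) (hn 0) h1
    have hs' : Summable fun x : ι × (Fin n → ι) => f 0 x.1 * ∏ j : Fin n, f j.succ (x.2 j) :=
      hs.of_norm
    have he : ∀ x : ι × (Fin n → ι), ∏ j, f j (e x j) = f 0 x.1 * ∏ j : Fin n, f j.succ (x.2 j) := by
      intro x
      rw [Fin.prod_univ_succ]
      simp [e]
    refine ⟨?_, ?_⟩
    · rw [← e.summable_iff]
      exact hs.congr fun x => by rw [Function.comp_apply, he]
    · rw [← e.hasSum_iff, Fin.prod_univ_succ, Function.comp_def, funext he]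
      exact HasSum.mul (f := f 0) (g := fun y : Fin n → ι => ∏ j : Fin n, f j.succ (y j)) (hf 0) h2 hs'

/-! ### The form `residueForm` and the affine rotation -/

/-- The exponent `∑ j, (l y_j (y_j - 1) / 2 + j y_j)`. -/
def residueForm (l : ℕ) (y : Fin l → ℤ) : ℤ := ∑ j, ((l : ℤ) * tri (y j) + (j : ℕ) * y j)

/-- For `x < 0` one has `tri x ≥ -x`, and `j < l` does the rest. -/
theorem residueForm_term_pos {l : ℕ} (j : Fin l) {x : ℤ} (hx : x < 0) :
    0 < (l : ℤ) * tri x + (j : ℕ) * x := by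
  have h := two_mul_tri x
  have hj : ((j : ℕ) : ℤ) + 1 ≤ l := by exact_mod_cast j.2
  have h1 : -x ≤ tri x := by nlinarith
  have h2 := mul_le_mul_of_nonneg_left h1 (Int.natCast_nonneg l)
  nlinarith

theorem residueForm_term_nonneg {l : ℕ} (j : Fin l) (x : ℤ) :
    0 ≤ (l : ℤ) * tri x + (j : ℕ) * x := by
  rcases lt_or_ge x 0 with h | h
  · exact (residueForm_term_pos j h).le
  · exact add_nonneg (mul_nonneg (Int.natCast_nonneg l) (tri_nonneg x))
      (mul_nonneg (Int.natCast_nonneg _) h)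

theorem residueForm_nonneg (l : ℕ) (y : Fin l → ℤ) : 0 ≤ residueForm l y :=
  Finset.sum_nonneg fun j _ => residueForm_term_nonneg j (y j)

/-- The affine rotation `(y_0, …, y_n) ↦ (y_n + 1, y_0, …, y_{n-1})`. -/
def affineRotate (n : ℕ) : Equiv.Perm (Fin (n + 1) → ℤ) where
  toFun y := Fin.cons (α := fun _ => ℤ) (y (Fin.last n) + 1) fun i => y i.castSucc
  invFun z := Fin.snoc (α := fun _ => ℤ) (fun i => z i.succ) (z 0 - 1)
  left_inv y := by
    funext i
    refine Fin.lastCases ?_ (fun j => ?_) i <;> simp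
  right_inv z := by
    funext i
    refine Fin.cases ?_ (fun j => ?_) i <;> simp

theorem sum_affineRotate (n : ℕ) (y : Fin (n + 1) → ℤ) :
    ∑ j, affineRotate n y j = ∑ j, y j + 1 := by
  rw [Fin.sum_univ_succ, Fin.sum_univ_castSucc y]
  simp only [affineRotate, Equiv.coe_fn_mk, Fin.cons_zero, Fin.cons_succ]
  ring

/-- A coordinate moved one place up gains one unit of weight. The last one drops from weight `n` to
`0`, but `(n + 1) * tri (y + 1)` supplies `(n + 1) * y`, again a net gain of `y`. -/
theorem residueForm_affineRotate (n : ℕ) (y : Fin (n + 1) → ℤ) :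
    residueForm (n + 1) (affineRotate n y) = residueForm (n + 1) y + ∑ j, y j := by
  unfold residueForm
  rw [Fin.sum_univ_succ, Fin.sum_univ_castSucc y, Fin.sum_univ_castSucc]
  simp only [affineRotate, Equiv.coe_fn_mk, Fin.cons_zero, Fin.cons_succ, tri_add_one,
    Fin.val_zero, Fin.val_succ, Fin.val_castSucc, Fin.val_last]
  push_cast
  simp only [add_mul, Finset.sum_add_distrib, one_mul, zero_mul]
  ring

/-- Each rotation adds the current sum to the form and then raises that sum by one, so the
increments form an arithmetic progression. -/
theorem affineRotate_zpow (n : ℕ) (y : Fin (n + 1) → ℤ) (s : ℤ) :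
    ∑ j, (affineRotate n ^ s) y j = ∑ j, y j + s ∧
      residueForm (n + 1) ((affineRotate n ^ s) y) =
        residueForm (n + 1) y + s * ∑ j, y j + tri s := by
  have step : ∀ s : ℤ, (affineRotate n ^ (s + 1)) y = affineRotate n ((affineRotate n ^ s) y) := by
    intro s
    rw [add_comm s 1, zpow_add, zpow_one, Equiv.Perm.mul_apply]
  induction s using Int.induction_on with
  | zero => simp [tri_zero]
  | succ s ih =>
    rw [step, sum_affineRotate, residueForm_affineRotate, ih.1, ih.2, tri_add_one]
    constructor <;> ring
  | pred s ih =>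
    have h := step (-s - 1)
    have h1 := sum_affineRotate n ((affineRotate n ^ (-(s : ℤ) - 1)) y)
    have h2 := residueForm_affineRotate n ((affineRotate n ^ (-(s : ℤ) - 1)) y)
    have h3 := tri_add_one (-(s : ℤ) - 1)
    rw [← h] at h1 h2
    rw [sub_add_cancel] at h1 h2 h3
    rw [ih.1] at h1
    rw [ih.2] at h2
    constructor
    · linarith
    · have : ∑ j, (affineRotate n ^ (-(s : ℤ) - 1)) y j = ∑ j, y j + (-s - 1) := by linarith
      rw [this] at h2
      linarith

/-- Every integer vector is, in a unique way, an iterated affine rotation of a vector with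
coordinate sum zero. -/
theorem exists_residueForm_decomposition {l : ℕ} (hl : 0 < l) :
    ∃ e : ℤ × {y : Fin l → ℤ // ∑ j, y j = 0} ≃ (Fin l → ℤ), ∀ x,
      ∑ j, e x j = x.1 ∧ residueForm l (e x) = residueForm l x.2 + tri x.1 := by
  obtain ⟨n, rfl⟩ : ∃ n, l = n + 1 := ⟨l - 1, by omega⟩
  refine ⟨{
    toFun := fun x => (affineRotate n ^ x.1) x.2
    invFun := fun z => (∑ j, z j, ⟨(affineRotate n ^ (-∑ j, z j)) z, by
      rw [(affineRotate_zpow n z _).1]; ring⟩)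
    left_inv := ?_
    right_inv := ?_ }, ?_⟩
  · rintro ⟨s, y, hy⟩
    have hs : ∑ j, (affineRotate n ^ s) y j = s := by rw [(affineRotate_zpow n y s).1, hy, zero_add]
    ext1
    · exact hs
    · apply Subtype.ext
      simp only [hs]
      rw [← Equiv.Perm.mul_apply, ← zpow_add, neg_add_cancel, zpow_zero, Equiv.Perm.one_apply]
  · intro z
    simp only
    rw [← Equiv.Perm.mul_apply, ← zpow_add, add_neg_cancel, zpow_zero, Equiv.Perm.one_apply]
  · rintro ⟨s, y, hy⟩
    have h := affineRotate_zpow n y s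
    rw [hy] at h
    simpa using h

/-! ### Theta series of `residueForm` and of its sum-zero part -/

/-- An infinite product over the natural numbers, split into residue classes. -/
theorem prod_tprod_residue {f : ℕ → ℂ} (hf : Summable fun n => ‖f n‖) {l : ℕ} (hl : 0 < l) :
    ∏ j : Fin l, ∏' k : ℕ, (1 + f (j + l * k)) = ∏' n : ℕ, (1 + f n) := by
  have : NeZero l := ⟨hl.ne'⟩
  have h := (multipliable_one_add_of_summable hf).hasProd
  let e : Fin l × ℕ ≃ ℕ := (Equiv.prodComm _ _).trans (Nat.divModEquiv l).symm
  have he : ∀ x : Fin l × ℕ, e x = x.1 + l * x.2 := by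
    rintro ⟨j, k⟩
    simp [e, Nat.divModEquiv]
    ring
  rw [← e.hasProd_iff] at h
  have hfib : ∀ j : Fin l, HasProd (fun k : ℕ => ((fun n => 1 + f n) ∘ e) (j, k))
      (∏' k : ℕ, (1 + f (j + l * k))) := by
    intro j
    simp only [Function.comp_def, he]
    refine (multipliable_one_add_of_summable ?_).hasProd
    refine hf.comp_injective (i := fun k : ℕ => (j : ℕ) + l * k) fun a b hab => ?_
    simpa [hl.ne'] using hab
  exact (hasProd_fintype _).unique (h.prod_fiberwise hfib)

theorem one_add_pow_ne_zero {q : ℂ} (hq : ‖q‖ < 1) (n : ℕ) : 1 + q ^ n ≠ 0 := by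
  rcases Nat.eq_zero_or_pos n with rfl | h
  · norm_num
  · intro h0
    have h1 : q ^ n = -1 := by linear_combination h0
    have h2 := congrArg norm h1
    rw [norm_pow, norm_neg, norm_one] at h2
    exact absurd h2 (pow_lt_one₀ (norm_nonneg _) hq h.ne').ne

theorem norm_pow_lt_one {q : ℂ} (hq : ‖q‖ < 1) {n : ℕ} (hn : n ≠ 0) : ‖q ^ n‖ < 1 := by
  rw [norm_pow]
  exact pow_lt_one₀ (norm_nonneg _) hq hn

theorem hasSum_residueForm {q : ℂ} (hq0 : q ≠ 0) (hq : ‖q‖ < 1) {l : ℕ} (hl : 0 < l) :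
    (Summable fun y : Fin l → ℤ => ‖q ^ residueForm l y‖) ∧
      HasSum (fun y : Fin l → ℤ => q ^ residueForm l y)
        (eulerPhi (q ^ l) ^ l * ((∏' k : ℕ, (1 + q ^ k)) * ∏' k : ℕ, (1 + q ^ (k + 1)))) := by
  have hp0 : q ^ l ≠ 0 := pow_ne_zero _ hq0
  have hp := norm_pow_lt_one hq hl.ne'
  have hw : ∀ j : Fin l, q ^ (j : ℕ) ≠ 0 := fun j => pow_ne_zero _ hq0
  have h := hasSum_pi_prod l (fun j y => (q ^ l) ^ tri y * (q ^ (j : ℕ)) ^ y) _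
    (fun j => summable_theta hp0 hp (hw j)) (fun j => hasSum_theta hp0 hp (hw j))
  have hterm : ∀ y : Fin l → ℤ, ∏ j, ((q ^ l) ^ tri (y j) * (q ^ (j : ℕ)) ^ y j) =
      q ^ residueForm l y := by
    intro y
    have hsum : ∀ (s : Finset (Fin l)) (g : Fin l → ℤ), q ^ (∑ j ∈ s, g j) = ∏ j ∈ s, q ^ g j := by
      classical
      intro s g
      induction s using Finset.induction_on with
      | empty => simp
      | insert a s ha ih => rw [Finset.sum_insert ha, Finset.prod_insert ha, zpow_add₀ hq0, ih]
    rw [residueForm, hsum]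
    refine Finset.prod_congr rfl fun j _ => ?_
    rw [zpow_add₀ hq0, zpow_mul, zpow_mul, zpow_natCast, zpow_natCast]
  simp only [hterm] at h
  refine ⟨h.1, ?_⟩
  convert h.2 using 1
  rw [Finset.prod_mul_distrib, Finset.prod_const, Finset.card_univ, Fintype.card_fin,
    Finset.prod_mul_distrib]
  congr 2
  · rw [← prod_tprod_residue (f := fun n => q ^ n) (by simpa using summable_norm_mul_pow hq 1) hl]
    refine Finset.prod_congr rfl fun j _ => tprod_congr fun k => ?_
    rw [pow_add, pow_mul]
  -- The second factors have exponents `l - j + l k`; reversing `j` makes `l - j` run through `j +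
  -- 1`.
  · rw [← prod_tprod_residue (f := fun n => q ^ (n + 1))
      (by simpa [pow_succ, mul_comm] using summable_norm_mul_pow hq q) hl, ← Equiv.prod_comp Fin.revPerm]
    refine Finset.prod_congr rfl fun j _ => tprod_congr fun k => ?_
    have hj : l = (Fin.revPerm j : ℕ) + 1 + j := by
      simp [Fin.val_rev]; omega
    have : q ^ l * (q ^ (j : ℕ))⁻¹ = q ^ ((Fin.revPerm j : ℕ) + 1) := by
      rw [← div_eq_mul_inv, div_eq_iff (hw j), ← pow_add, ← hj]
    rw [this, ← pow_mul, ← pow_add]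
    congr 2
    ring

theorem hasSum_tri {q : ℂ} (hq0 : q ≠ 0) (hq : ‖q‖ < 1) :
    HasSum (fun y : ℤ => q ^ tri y)
      (eulerPhi q * ((∏' k : ℕ, (1 + q ^ k)) * ∏' k : ℕ, (1 + q ^ (k + 1)))) := by
  have := hasSum_theta hq0 hq one_ne_zero
  simpa [pow_succ', mul_comm] using this

theorem summable_norm_tri {q : ℂ} (hq0 : q ≠ 0) (hq : ‖q‖ < 1) :
    Summable fun y : ℤ => ‖q ^ tri y‖ := by
  simpa using summable_theta hq0 hq one_ne_zero

theorem tprod_one_add_pow_ne_zero {q : ℂ} (hq : ‖q‖ < 1) : ∏' k : ℕ, (1 + q ^ k) ≠ 0 :=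
  tprod_one_add_ne_zero_of_summable (fun k => one_add_pow_ne_zero hq k)
    (by simpa using summable_norm_mul_pow hq 1)

theorem tprod_one_add_pow_succ_ne_zero {q : ℂ} (hq : ‖q‖ < 1) :
    ∏' k : ℕ, (1 + q ^ (k + 1)) ≠ 0 :=
  tprod_one_add_ne_zero_of_summable (fun k => one_add_pow_ne_zero hq (k + 1))
    (by simpa [pow_succ, mul_comm] using summable_norm_mul_pow hq q)

/-- The theta series of the sum-zero sublattice. -/
theorem hasSum_residueForm_sum_zero {q : ℂ} (hq0 : q ≠ 0) (hq : ‖q‖ < 1) {l : ℕ} (hl : 0 < l) :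
    (Summable fun y : {y : Fin l → ℤ // ∑ j, y j = 0} => ‖q ^ residueForm l y‖) ∧
    HasSum (fun y : {y : Fin l → ℤ // ∑ j, y j = 0} => q ^ residueForm l y)
      (eulerPhi (q ^ l) ^ l / eulerPhi q) := by
  obtain ⟨hs, hS⟩ := hasSum_residueForm hq0 hq hl
  obtain ⟨e, he⟩ := exists_residueForm_decomposition hl
  have hs0 : Summable fun y : {y : Fin l → ℤ // ∑ j, y j = 0} => ‖q ^ residueForm l y‖ :=
    hs.comp_injective Subtype.val_injective
  refine ⟨hs0, ?_⟩
  have hZ := hs0.of_norm.hasSum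
  have hT := hasSum_tri hq0 hq
  have hprod := hT.mul hZ ((summable_norm_tri hq0 hq).mul_norm hs0).of_norm
  rw [← e.hasSum_iff] at hS
  have hcongr : (fun y => q ^ residueForm l y) ∘ e =
      fun x : ℤ × {y : Fin l → ℤ // ∑ j, y j = 0} => q ^ tri x.1 * q ^ residueForm l x.2 := by
    funext x
    rw [Function.comp_apply, (he x).2, zpow_add₀ hq0, mul_comm]
  rw [hcongr] at hS
  -- Both sides contain the same two infinite products, from `hasSum_tri` and `hasSum_residueForm`;
  -- they are nonzero and cancel.
  have heq := hprod.unique hS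
  have h1 := tprod_one_add_pow_ne_zero hq
  have h2 := tprod_one_add_pow_succ_ne_zero hq
  have h3 := eulerPhi_ne_zero hq
  have hv : eulerPhi (q ^ l) ^ l / eulerPhi q =
      ∑' y : {y : Fin l → ℤ // ∑ j, y j = 0}, q ^ residueForm l y := by
    rw [div_eq_iff h3]
    apply mul_right_cancel₀ (mul_ne_zero h1 h2)
    linear_combination -heq
  rw [hv]
  exact hZ

/-! ### Gauss's identity -/

theorem tprod_one_add_pow_succ {q : ℂ} (hq : ‖q‖ < 1) :
    ∏' k : ℕ, (1 + q ^ (k + 1)) = eulerPhi (q ^ 2) / eulerPhi q := by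
  rw [eq_div_iff (eulerPhi_ne_zero hq)]
  unfold eulerPhi
  rw [← Multipliable.tprod_mul
    (by simpa [pow_succ, mul_comm] using multipliable_one_add_mul_pow hq q)
    (multipliable_one_sub_pow_succ hq)]
  exact tprod_congr fun k => by ring

theorem HasSum.int_even_add_odd {f : ℤ → ℂ} {a b : ℂ} (he : HasSum (fun k => f (2 * k)) a)
    (ho : HasSum (fun k => f (2 * k + 1)) b) : HasSum f (a + b) := by
  have := mul_right_injective₀ (two_ne_zero' ℤ)
  replace ho := ((add_left_injective 1).comp this).hasSum_range_iff.2 ho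
  refine (this.hasSum_range_iff.2 he).add_isCompl ?_ ho
  have h1 : Set.range (fun k : ℤ => 2 * k) = {n | Even n} := by
    ext n
    simp [even_iff_exists_two_mul]
  have h2 : Set.range ((fun k : ℤ => k + 1) ∘ fun k => 2 * k) = {n | Odd n} := by
    ext n
    simp [Odd, eq_comm]
  rw [h1, h2]
  exact Int.isCompl_even_odd

/-- Gauss's identity for the triangular numbers, written as a bilateral series. -/
theorem hasSum_gauss {q : ℂ} (hq0 : q ≠ 0) (hq : ‖q‖ < 1) :
    HasSum (fun s : ℤ => q ^ (2 * s ^ 2 - s)) (eulerPhi (q ^ 2) ^ 2 / eulerPhi q) := by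
  have hT := hasSum_tri hq0 hq
  have h0 : ∏' k : ℕ, (1 + q ^ k) = 2 * ∏' k : ℕ, (1 + q ^ (k + 1)) := by
    have hm' : Multipliable fun k : ℕ => 1 + q ^ (k + 1) := by
      simpa [pow_succ, mul_comm] using multipliable_one_add_mul_pow hq q
    rw [tprod_eq_zero_mul' (f := fun k : ℕ => 1 + q ^ k) hm', pow_zero, one_add_one_eq_two]
  have he : ∀ s : ℤ, tri (2 * s) = 2 * s ^ 2 - s := fun s => by
    have := two_mul_tri (2 * s); linarith
  -- The symmetry `y ↦ 1 - y` of `tri` makes the odd half of the series equal to the even half; the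
  -- resulting factor 2 cancels the factor `1 + q ^ 0`.
  have ho : ∀ s : ℤ, tri (1 - 2 * s) = 2 * s ^ 2 - s := fun s => by
    have := two_mul_tri (1 - 2 * s); linarith
  have hsum : Summable fun s : ℤ => q ^ (2 * s ^ 2 - s) := by
    have := hT.summable.comp_injective (mul_right_injective₀ (two_ne_zero' ℤ))
    exact this.congr fun s => by rw [Function.comp_apply, he]
  obtain ⟨v, hv⟩ := hsum
  have hev : HasSum (fun s : ℤ => q ^ tri (2 * s)) v := by simpa only [he] using hv
  have hod : HasSum (fun s : ℤ => q ^ tri (2 * s + 1)) v := by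
    rw [← (Equiv.neg ℤ).hasSum_iff]
    have hc : (fun s : ℤ => q ^ tri (2 * s + 1)) ∘ Equiv.neg ℤ = fun s => q ^ (2 * s ^ 2 - s) := by
      funext s
      rw [← ho, Function.comp_apply, Equiv.neg_apply]
      congr 2
      ring
    rw [hc]
    exact hv
  have h2v := (hev.int_even_add_odd (f := fun y => q ^ tri y) hod).unique hT
  rw [tprod_one_add_pow_succ hq] at h0 h2v
  rw [h0] at h2v
  have h3 := eulerPhi_ne_zero hq
  have hval : eulerPhi (q ^ 2) ^ 2 / eulerPhi q = v := by
    rw [div_eq_iff h3]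
    field_simp at h2v
    linear_combination -h2v / 2
  rw [hval]
  exact hv

/-! ### Change of variables in the exponent -/

/-- Extension of a finite sequence by zero. -/
def extendZero {l : ℕ} (k : Fin l → ℤ) (i : ℕ) : ℤ := if h : i < l then k ⟨i, h⟩ else 0

theorem extendZero_val {l : ℕ} (k : Fin l → ℤ) (i : Fin l) : extendZero k i = k i := by
  simp [extendZero]

theorem extendZero_of_le {l : ℕ} (k : Fin l → ℤ) {i : ℕ} (h : l ≤ i) : extendZero k i = 0 := by
  simp [extendZero, h]

/-- The change of variables `y_i = k_{i+1} - k_i`, where `k` is extended by zero. -/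
def diffEquiv (l : ℕ) : (Fin l → ℤ) ≃ (Fin l → ℤ) where
  toFun k i := extendZero k (i + 1) - extendZero k i
  invFun y i := -∑ j ∈ Finset.Ico (i : ℕ) l, extendZero y j
  left_inv k := by
    funext i
    have h : ∀ j ∈ Finset.Ico (i : ℕ) l,
        extendZero (fun i : Fin l => extendZero k (i + 1) - extendZero k i) j =
          extendZero k (j + 1) - extendZero k j := by
      intro j hj
      rw [extendZero, dif_pos (Finset.mem_Ico.1 hj).2]
    beta_reduce
    rw [Finset.sum_congr rfl h, Finset.sum_Ico_sub _ i.2.le, extendZero_of_le k le_rfl,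
      extendZero_val]
    ring
  right_inv y := by
    have h : ∀ t ≤ l, extendZero (fun i : Fin l => -∑ j ∈ Finset.Ico (i : ℕ) l, extendZero y j) t =
        -∑ j ∈ Finset.Ico t l, extendZero y j := by
      intro t ht
      rcases ht.eq_or_lt with rfl | ht
      · rw [extendZero_of_le _ le_rfl, Finset.Ico_self, Finset.sum_empty, neg_zero]
      · rw [extendZero, dif_pos ht]
    funext i
    beta_reduce
    rw [h (i + 1) i.2, h i i.2.le, Finset.sum_eq_sum_Ico_succ_bot i.2, extendZero_val]
    ring

theorem diffEquiv_apply {l : ℕ} (k : Fin l → ℤ) (i : Fin l) :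
    diffEquiv l k i = extendZero k (i + 1) - extendZero k i := rfl

theorem sum_diffEquiv {l : ℕ} (k : Fin l → ℤ) : ∑ i, diffEquiv l k i = -extendZero k 0 := by
  simp only [diffEquiv_apply]
  rw [Fin.sum_univ_eq_sum_range (fun i => extendZero k (i + 1) - extendZero k i),
    Finset.sum_range_sub, extendZero_of_le k le_rfl, zero_sub]

/-- With zeros appended at both ends, `2κ` is the sum of squares of consecutive differences.
`diffEquiv` includes the right end but not the left, hence the extra square. -/
theorem two_mul_kappa {l : ℕ} (hl : 0 < l) (k : Fin l → ℤ) :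
    2 * kappa k = ∑ i, diffEquiv l k i ^ 2 + extendZero k 0 ^ 2 := by
  obtain ⟨n, rfl⟩ : ∃ n, l = n + 1 := ⟨l - 1, by omega⟩
  have h1 : ∑ i : Fin (n + 1), k i ^ 2 = ∑ i ∈ Finset.range (n + 1), extendZero k i ^ 2 := by
    rw [← Fin.sum_univ_eq_sum_range (fun i => extendZero k i ^ 2)]
    simp only [extendZero_val]
  have h2 : ∑ i : Fin (n + 1 - 1), k ⟨i.val, by omega⟩ * k ⟨i.val + 1, by omega⟩ =
      ∑ i ∈ Finset.range (n + 1), extendZero k i * extendZero k (i + 1) := by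
    rw [Finset.sum_range_succ, extendZero_of_le k le_rfl, mul_zero, add_zero]
    rw [← Fin.sum_univ_eq_sum_range (fun i => extendZero k i * extendZero k (i + 1))]
    refine Finset.sum_congr rfl fun i _ => ?_
    have hi : (i : ℕ) < n := i.2
    rw [extendZero, extendZero, dif_pos (by omega), dif_pos (by omega)]
  have h3 : ∑ i, diffEquiv (n + 1) k i ^ 2 =
      ∑ i ∈ Finset.range (n + 1), (extendZero k (i + 1) - extendZero k i) ^ 2 := by
    rw [← Fin.sum_univ_eq_sum_range (fun i => (extendZero k (i + 1) - extendZero k i) ^ 2)]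
    rfl
  have h4 : ∑ i ∈ Finset.range (n + 1), (extendZero k (i + 1) ^ 2 - extendZero k i ^ 2) =
      -extendZero k 0 ^ 2 := by
    rw [Finset.sum_range_sub (fun i => extendZero k i ^ 2), extendZero_of_le k le_rfl]
    ring
  have h5 : ∑ i ∈ Finset.range (n + 1), (extendZero k (i + 1) - extendZero k i) ^ 2 =
      ∑ i ∈ Finset.range (n + 1), (extendZero k (i + 1) ^ 2 - extendZero k i ^ 2) +
        2 * ∑ i ∈ Finset.range (n + 1), extendZero k i ^ 2 -
        2 * ∑ i ∈ Finset.range (n + 1), extendZero k i * extendZero k (i + 1) := by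
    rw [Finset.mul_sum, Finset.mul_sum, ← Finset.sum_add_distrib, ← Finset.sum_sub_distrib]
    exact Finset.sum_congr rfl fun i _ => by ring
  rw [kappa, h1, h2, h3, h5, h4]
  ring

theorem sum_range_sub_mul_succ (a K : ℕ → ℤ) (n : ℕ) :
    ∑ i ∈ Finset.range n, (a i - a (i + 1)) * K (i + 1) =
      ∑ i ∈ Finset.range (n + 1), a i * (K (i + 1) - K i) + a 0 * K 0 - a n * K (n + 1) := by
  induction n with
  | zero => simp; ring
  | succ n ih => rw [Finset.sum_range_succ, ih, Finset.sum_range_succ _ (n + 1)]; ring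

/-- Summation by parts: the weights `(i + m) mod (4m - 1)` rise by 1, giving coefficients `-1`, and
fall by `4m - 2` at the wrap `i = 3m - 1`, which is the variable `k_{3m}`. The boundary contributes
`(2m - 1) + m = 3m - 1`. -/
theorem lin_eq {m : ℕ} (hm : 0 < m) (k : Fin (4 * m - 1) → ℤ) :
    lin m k = ∑ i : Fin (4 * m - 1), (((i + m) % (4 * m - 1) : ℕ) : ℤ) * diffEquiv _ k i +
      (3 * m - 1) * extendZero k 0 := by
  obtain ⟨n, hn⟩ : ∃ n, 4 * m - 1 = n + 1 := ⟨4 * m - 2, by omega⟩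
  let a : ℕ → ℤ := fun i => (((i + m) % (4 * m - 1) : ℕ) : ℤ)
  let c : ℕ → ℤ := fun i => if i + 1 = 1 then 2 * (m : ℤ) - 1
    else if i + 1 = 3 * m then 4 * (m : ℤ) - 2 else -1
  have ha : ∀ i, i < 4 * m - 1 → a i = if i + m < 4 * m - 1 then (i : ℤ) + m
      else (i : ℤ) + m - (4 * m - 1) := by
    intro i hi
    simp only [a]
    split_ifs with h
    · rw [Nat.mod_eq_of_lt h]; push_cast; ring
    · rw [Nat.mod_eq_sub_mod (by omega), Nat.mod_eq_of_lt (by omega)]; omega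
  have hc : ∀ i, i + 1 < 4 * m - 1 → c (i + 1) = a i - a (i + 1) := by
    intro i hi
    rw [ha i (by omega), ha (i + 1) hi]
    simp only [c]
    split_ifs <;> push_cast <;> omega
  have h1 : lin m k = ∑ i ∈ Finset.range (4 * m - 1), c i * extendZero k i := by
    rw [← Fin.sum_univ_eq_sum_range (fun i => c i * extendZero k i), lin]
    simp only [extendZero_val]
    rfl
  have h2 : ∑ i : Fin (4 * m - 1), (((i + m) % (4 * m - 1) : ℕ) : ℤ) * diffEquiv _ k i =
      ∑ i ∈ Finset.range (4 * m - 1), a i * (extendZero k (i + 1) - extendZero k i) := by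
    rw [← Fin.sum_univ_eq_sum_range (fun i => a i * (extendZero k (i + 1) - extendZero k i))]
    rfl
  have h3 := sum_range_sub_mul_succ a (extendZero k) n
  have h4 : ∑ i ∈ Finset.range n, (a i - a (i + 1)) * extendZero k (i + 1) =
      ∑ i ∈ Finset.range n, c (i + 1) * extendZero k (i + 1) := by
    refine Finset.sum_congr rfl fun i hi => ?_
    rw [hc i (by have := Finset.mem_range.1 hi; omega)]
  have h5 : extendZero k (n + 1) = 0 := extendZero_of_le k hn.le
  have h6 : a 0 = m := by
    rw [ha 0 (by omega), if_pos (by omega)]; simp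
  have h7 : c 0 = 2 * m - 1 := by simp [c]
  rw [h1, h2]
  generalize extendZero k = K at h3 h4 h5 ⊢
  rw [hn, Finset.sum_range_succ', ← h4, h3, h5, h6, h7]
  ring

/-- In suitable coordinates `gaussExponent` is `residueForm` up to a quadratic polynomial in the
sum of the coordinates. -/
theorem exists_gaussExponent_equiv {m : ℕ} (hm : 0 < m) :
    ∃ e : (Fin (4 * m - 1) → ℤ) ≃ (Fin (4 * m - 1) → ℤ), ∀ k,
      gaussExponent m k = residueForm (4 * m - 1) (e k) - tri (∑ j, e k j) +
        m * (2 * (∑ j, e k j) ^ 2 - ∑ j, e k j) := by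
  have : NeZero (4 * m - 1) := ⟨by omega⟩
  -- Rotation by `m` makes each weight equal to the index of its coordinate, as `residueForm`
  -- requires.
  let r : Fin (4 * m - 1) ≃ Fin (4 * m - 1) := Equiv.addRight ⟨m, by omega⟩
  have hr : ∀ i, ((r i : Fin (4 * m - 1)) : ℕ) = (i + m) % (4 * m - 1) := fun i => by
    simp [r, Fin.val_add]
  refine ⟨(diffEquiv _).trans (r.arrowCongr (Equiv.refl ℤ)), fun k => ?_⟩
  set y := diffEquiv _ k with hy
  have happ : ∀ j, (((diffEquiv _).trans (r.arrowCongr (Equiv.refl ℤ))) k) (r j) = y j := by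
    intro j
    simp [hy, Equiv.arrowCongr]
  have hs : ∑ j, (((diffEquiv _).trans (r.arrowCongr (Equiv.refl ℤ))) k) j = -extendZero k 0 := by
    rw [← Equiv.sum_comp r]
    simp only [happ]
    exact sum_diffEquiv k
  have hG : residueForm (4 * m - 1) (((diffEquiv _).trans (r.arrowCongr (Equiv.refl ℤ))) k) =
      ∑ j, ((4 * m - 1 : ℤ) * tri (y j) + (((j + m) % (4 * m - 1) : ℕ) : ℤ) * y j) := by
    rw [residueForm, ← Equiv.sum_comp r]
    simp only [happ, hr]
    have : ((4 * m - 1 : ℕ) : ℤ) = 4 * m - 1 := by omega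
    rw [this]
  rw [hs, hG, gaussExponent, lin_eq hm k, Finset.sum_add_distrib, ← Finset.mul_sum]
  have hk := two_mul_kappa (by omega) k
  have ht : 2 * ∑ j, tri (y j) = ∑ j, y j ^ 2 + extendZero k 0 := by
    have h := sum_diffEquiv k
    rw [← hy] at h
    rw [Finset.mul_sum, ← neg_neg (extendZero k 0), ← h, ← sub_eq_add_neg,
      ← Finset.sum_sub_distrib]
    exact Finset.sum_congr rfl fun j _ => by rw [two_mul_tri]; ring
  have ht0 := two_mul_tri (-extendZero k 0)
  rw [← hy] at hk ⊢
  have h2 : (2 : ℤ) ≠ 0 := two_ne_zero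
  apply mul_left_cancel₀ h2
  linear_combination (4 * (m : ℤ) - 1) * hk - (4 * (m : ℤ) - 1) * ht + ht0

/-! ### Separation of the exponent and the analytic identity -/

/-- A parametrization of the summation variables in which `gaussExponent` separates. -/
theorem exists_gaussExponent_decomposition {m : ℕ} (hm : 0 < m) :
    ∃ e : ℤ × {y : Fin (4 * m - 1) → ℤ // ∑ j, y j = 0} ≃ (Fin (4 * m - 1) → ℤ), ∀ x,
      gaussExponent m (e x) = m * (2 * x.1 ^ 2 - x.1) + residueForm (4 * m - 1) x.2 := by
  obtain ⟨e, he⟩ := exists_gaussExponent_equiv hm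
  obtain ⟨d, hd⟩ := exists_residueForm_decomposition (l := 4 * m - 1) (by omega)
  refine ⟨d.trans e.symm, fun x => ?_⟩
  rw [he, Equiv.trans_apply, Equiv.apply_symm_apply, (hd x).1, (hd x).2]
  ring

theorem two_mul_sq_sub_self_nonneg (s : ℤ) : 0 ≤ 2 * s ^ 2 - s := by
  rcases le_or_gt s 0 with h | h <;> nlinarith

theorem gaussExponent_nonneg {m : ℕ} (hm : 0 < m) (k : Fin (4 * m - 1) → ℤ) :
    0 ≤ gaussExponent m k := by
  obtain ⟨e, he⟩ := exists_gaussExponent_decomposition hm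
  obtain ⟨x, rfl⟩ := e.surjective k
  rw [he]
  exact add_nonneg (mul_nonneg (by positivity) (two_mul_sq_sub_self_nonneg _))
    (residueForm_nonneg _ _)

theorem eq_zero_of_residueForm_eq_zero {l : ℕ} {y : Fin l → ℤ} (hs : ∑ j, y j = 0)
    (h : residueForm l y = 0) : y = 0 := by
  have h0 := (Finset.sum_eq_zero_iff_of_nonneg fun j _ => residueForm_term_nonneg j (y j)).1 h
  have hy : ∀ j, 0 ≤ y j := fun j => by
    by_contra hj
    exact (residueForm_term_pos j (not_le.1 hj)).ne' (h0 j (Finset.mem_univ j))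
  funext j
  exact (Finset.sum_eq_zero_iff_of_nonneg fun j _ => hy j).1 hs j (Finset.mem_univ j)

theorem eulerPhi_zero : eulerPhi (0 : ℂ) = 1 := by
  simp [eulerPhi]

theorem hasSum_gaussExponent {m : ℕ} (hm : 0 < m) {q : ℂ} (hq : ‖q‖ < 1) :
    HasSum (fun k : Fin (4 * m - 1) → ℤ => q ^ gaussExponent m k)
      (eulerPhi (q ^ (4 * m - 1)) ^ (4 * m - 1) * eulerPhi (q ^ (2 * m)) ^ 2 /
        (eulerPhi q * eulerPhi (q ^ m))) := by
  obtain ⟨e, he⟩ := exists_gaussExponent_decomposition hm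
  rw [← e.hasSum_iff]
  simp only [Function.comp_def, he]
  rcases eq_or_ne q 0 with rfl | hq0
  -- At `q = 0` the convention `0 ^ 0 = 1` leaves only terms of exponent zero; both summands must
  -- then vanish, which singles out the origin.
  · rw [zero_pow (by omega), zero_pow (by omega), zero_pow (by omega), eulerPhi_zero]
    convert hasSum_single
      ((0, ⟨0, by simp⟩) : ℤ × {y : Fin (4 * m - 1) → ℤ // ∑ j, y j = 0}) ?_ using 1
    · simp [residueForm, tri_zero]
    · rintro ⟨s, y, hy⟩ hne
      refine zero_zpow _ fun h => hne ?_
      have h1 := mul_nonneg (Int.natCast_nonneg m) (two_mul_sq_sub_self_nonneg s)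
      have h2 := residueForm_nonneg _ y
      have h3 : (m : ℤ) * (2 * s ^ 2 - s) = 0 := by simp only at h; linarith
      have h4 := eq_zero_of_residueForm_eq_zero hy (by simp only at h; linarith)
      have h5 : s * (2 * s - 1) = 0 := by
        have := (mul_eq_zero.1 h3).resolve_left (by exact_mod_cast hm.ne')
        linear_combination this
      have h6 : s = 0 := by
        rcases mul_eq_zero.1 h5 with h | h <;> omega
      subst h6
      subst h4
      rfl
  · obtain ⟨hs, hZ⟩ := hasSum_residueForm_sum_zero hq0 hq (l := 4 * m - 1) (by omega)
    have hp0 : q ^ m ≠ 0 := pow_ne_zero _ hq0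
    have hg := hasSum_gauss hp0 (norm_pow_lt_one hq hm.ne')
    have h := hg.mul hZ ((hg.summable.norm).mul_norm hs).of_norm
    have hval : eulerPhi (q ^ (4 * m - 1)) ^ (4 * m - 1) * eulerPhi (q ^ (2 * m)) ^ 2 /
        (eulerPhi q * eulerPhi (q ^ m)) = eulerPhi ((q ^ m) ^ 2) ^ 2 / eulerPhi (q ^ m) *
          (eulerPhi (q ^ (4 * m - 1)) ^ (4 * m - 1) / eulerPhi q) := by
      rw [div_mul_div_comm, ← pow_mul, mul_comm m 2]
      ring
    have hterm : (fun x : ℤ × {y : Fin (4 * m - 1) → ℤ // ∑ j, y j = 0} =>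
        q ^ (m * (2 * x.1 ^ 2 - x.1) + residueForm (4 * m - 1) x.2)) =
        fun x => (q ^ m) ^ (2 * x.1 ^ 2 - x.1) * q ^ residueForm (4 * m - 1) x.2 := by
      funext x
      rw [zpow_add₀ hq0, zpow_mul, zpow_natCast]
    rw [hval, hterm]
    exact h

/-! ### From complex evaluation to formal power series -/

/-- The power series `f` converges at `q`, with sum `v`. -/
def HasEval (f : PowerSeries ℂ) (q v : ℂ) : Prop :=
  HasSum (fun n : ℕ => PowerSeries.coeff n f * q ^ n) v

theorem HasEval.mul {f g : PowerSeries ℂ} {q u v : ℂ} (hf : HasEval f q u) (hg : HasEval g q v) :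
    HasEval (f * g) q (u * v) := by
  have hf' := hf.summable.norm
  have hg' := hg.summable.norm
  have hsum := (summable_norm_sum_mul_antidiagonal_of_summable_norm hf' hg').of_norm.hasSum
  rw [← tsum_mul_tsum_eq_tsum_sum_antidiagonal_of_summable_norm hf' hg', hf.tsum_eq,
    hg.tsum_eq] at hsum
  have hterm : (fun n : ℕ => PowerSeries.coeff n (f * g) * q ^ n) = fun n =>
      ∑ kl ∈ Finset.HasAntidiagonal.antidiagonal n, PowerSeries.coeff kl.1 f * q ^ kl.1 *
        (PowerSeries.coeff kl.2 g * q ^ kl.2) := by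
    funext n
    rw [PowerSeries.coeff_mul, Finset.sum_mul]
    refine Finset.sum_congr rfl fun kl hkl => ?_
    rw [← Finset.HasAntidiagonal.mem_antidiagonal.1 hkl, pow_add]
    ring
  rw [HasEval, hterm]
  exact hsum

theorem HasEval.one (q : ℂ) : HasEval 1 q 1 := by
  have h := hasSum_single (f := fun n : ℕ => PowerSeries.coeff n (1 : PowerSeries ℂ) * q ^ n) 0
    fun n hn => by simp [PowerSeries.coeff_one, hn]
  simpa [HasEval] using h

theorem HasEval.pow {f : PowerSeries ℂ} {q u : ℂ} (hf : HasEval f q u) (n : ℕ) :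
    HasEval (f ^ n) q (u ^ n) := by
  induction n with
  | zero => simpa using HasEval.one q
  | succ n ih => simpa only [pow_succ] using ih.mul hf

/-- A formally convergent sum of monomials may be evaluated termwise wherever the termwise
evaluation is summable. -/
theorem HasEval.of_hasSum {ι : Type*} {c : ι → ℂ} {e : ι → ℕ} {f : PowerSeries ℂ} {q v : ℂ}
    (hf : HasSum (fun i => PowerSeries.monomial (e i) (c i)) f)
    (hq : HasSum (fun i => c i * q ^ e i) v) : HasEval f q v := by
  -- Grouping the indices by exponent turns the evaluated sum into a sum over `n` of `coeff n f * q
  -- ^ n`.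
  rw [← (Equiv.sigmaFiberEquiv e).hasSum_iff] at hq
  refine hq.sigma fun n => ?_
  have h := ((PowerSeries.WithPiTopology.hasSum_iff_hasSum_coeff ℂ).1 hf n).mul_right (q ^ n)
  rw [← hasSum_subtype_iff_of_support_subset (s := {i | e i = n})] at h
  · have hc : ((fun i => PowerSeries.coeff n (PowerSeries.monomial (e i) (c i)) * q ^ n) ∘
        ((↑) : {i // e i = n} → ι)) = fun i : {i // e i = n} => c i * q ^ e i := by
      funext ⟨i, hi⟩
      simp [hi, PowerSeries.coeff_monomial]
    exact Eq.mp (congrArg (HasSum · (PowerSeries.coeff n f * q ^ n)) hc) h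
  · intro i hi
    by_contra hne
    refine hi ?_
    beta_reduce
    rw [PowerSeries.coeff_monomial, if_neg (fun h => hne h.symm), zero_mul]

theorem eq_of_hasEval {f g : PowerSeries ℂ} {F : ℂ → ℂ} (hf : ∀ q : ℂ, ‖q‖ < 1 → HasEval f q (F q))
    (hg : ∀ q : ℂ, ‖q‖ < 1 → HasEval g q (F q)) : f = g := by
  have key : ∀ f : PowerSeries ℂ, (∀ q : ℂ, ‖q‖ < 1 → HasEval f q (F q)) → HasFPowerSeriesAt F
      (FormalMultilinearSeries.ofScalars ℂ fun n => PowerSeries.coeff n f) 0 := by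
    intro f hf
    rw [hasFPowerSeriesAt_iff]
    filter_upwards [Metric.ball_mem_nhds (0 : ℂ) one_pos] with q hq
    have h := hf q (by simpa using hq)
    rw [zero_add]
    simpa [FormalMultilinearSeries.coeff_ofScalars, mul_comm, HasEval] using h
  have h := (key f hf).eq_formalMultilinearSeries (key g hg)
  ext n
  have := congrArg (fun p : FormalMultilinearSeries ℂ ℂ ℂ => p.coeff n) h
  simpa [FormalMultilinearSeries.coeff_ofScalars] using this

theorem HasEval.constantCoeff_eq {f : PowerSeries ℂ} {v : ℂ} (h : HasEval f 0 v) :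
    PowerSeries.constantCoeff f = v := by
  have h' := hasSum_single (f := fun n : ℕ => PowerSeries.coeff n f * (0 : ℂ) ^ n) 0
    fun n hn => by simp [hn]
  simpa using h'.unique h

theorem prod_neg_pow_pow {R : Type*} [CommRing R] (x : R) (a : ℕ) (s : Finset ℕ) :
    ∏ j ∈ s, -(x ^ a) ^ (j + 1) = (-1) ^ s.card * x ^ (∑ j ∈ s, a * (j + 1)) := by
  rw [Finset.prod_neg, Finset.prod_pow_eq_pow_sum, ← pow_mul, Finset.mul_sum]

/-- Expanding the product over finite sets of factors gives the same signed monomials formally and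
analytically, so `HasEval.of_hasSum` applies. -/
theorem hasEval_eulerPhi {a : ℕ} (ha : 0 < a) {q : ℂ} (hq : ‖q‖ < 1) :
    HasEval (eulerPhi ((PowerSeries.X : PowerSeries ℂ) ^ a)) q (eulerPhi (q ^ a)) := by
  have h1 : Summable fun s : Finset ℕ => ∏ j ∈ s, -((PowerSeries.X : PowerSeries ℂ) ^ a) ^ (j + 1) := by
    refine PowerSeries.WithPiTopology.summable_prod_of_tendsto_order_atTop_nhds_top ℂ ?_
    simp_rw [PowerSeries.order_neg, ← pow_mul, PowerSeries.order_X_pow]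
    refine ENat.tendsto_natCast_nhds_top.comp (tendsto_atTop.2 fun b => ?_)
    filter_upwards [eventually_ge_atTop b] with j hj
    nlinarith
  have h2 : Summable fun s : Finset ℕ => ∏ j ∈ s, -(q ^ a) ^ (j + 1) := by
    refine summable_finsetProd_of_summable_norm ?_
    have := summable_norm_mul_pow (norm_pow_lt_one hq ha.ne') (q ^ a)
    simpa [pow_succ, mul_comm] using this
  have e1 : eulerPhi ((PowerSeries.X : PowerSeries ℂ) ^ a) =
      ∑' s : Finset ℕ, ∏ j ∈ s, -((PowerSeries.X : PowerSeries ℂ) ^ a) ^ (j + 1) := by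
    rw [← tprod_one_add h1]
    rfl
  have e2 : eulerPhi (q ^ a) = ∑' s : Finset ℕ, ∏ j ∈ s, -(q ^ a) ^ (j + 1) := by
    rw [← tprod_one_add h2]
    simp only [eulerPhi, sub_eq_add_neg]
  have h1' := h1.hasSum
  have h2' := h2.hasSum
  rw [← e1] at h1'
  rw [← e2] at h2'
  simp only [prod_neg_pow_pow] at h1' h2'
  refine HasEval.of_hasSum ?_ h2'
  convert h1' using 2 with s
  rw [PowerSeries.monomial_eq_C_mul_X_pow]
  simp

/-- Summable terms tend to zero, so only finitely many can equal `(1 / 2) ^ n`. -/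
theorem finite_fiber_of_summable {ι : Type*} {e : ι → ℕ}
    (h : Summable fun i => (1 / 2 : ℂ) ^ e i) (n : ℕ) : {i | e i = n}.Finite := by
  have h0 := h.tendsto_cofinite_zero.norm
  rw [norm_zero] at h0
  have h1 := h0.eventually_lt_const (u := (1 / 2 : ℝ) ^ n) (by positivity)
  refine h1.subset fun i hi => ?_
  have hi' : e i = n := hi
  simp [hi']

theorem summable_X_pow {ι : Type*} {e : ι → ℕ} (h : ∀ n, {i | e i = n}.Finite) :
    Summable fun i => (PowerSeries.X : PowerSeries ℂ) ^ e i := by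
  rw [PowerSeries.WithPiTopology.summable_iff_summable_coeff]
  intro n
  refine summable_of_hasFiniteSupport ((h n).subset fun i hi => ?_)
  by_contra hne
  refine hi ?_
  beta_reduce
  rw [PowerSeries.coeff_X_pow, if_neg (fun h => hne h.symm)]

theorem mainTheorem1 (m : ℕ) (hm : 0 < m) :
    (∃ e : (Fin (4 * m - 1) → ℤ) → ℕ,
      (∀ k, (e k : ℤ) = gaussExponent m k) ∧
      HasSum (fun k : Fin (4 * m - 1) → ℤ => (PowerSeries.X : PowerSeries ℂ) ^ e k)
        (eulerPhi ((PowerSeries.X : PowerSeries ℂ) ^ (4 * m - 1)) ^ (4 * m - 1) *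
            eulerPhi ((PowerSeries.X : PowerSeries ℂ) ^ (2 * m)) ^ 2 *
          (eulerPhi (PowerSeries.X : PowerSeries ℂ) *
            eulerPhi ((PowerSeries.X : PowerSeries ℂ) ^ m))⁻¹)) ∧
    (∀ q : ℂ, ‖q‖ < 1 →
      HasSum (fun k : Fin (4 * m - 1) → ℤ => q ^ gaussExponent m k)
        (eulerPhi (q ^ (4 * m - 1)) ^ (4 * m - 1) * eulerPhi (q ^ (2 * m)) ^ 2 /
          (eulerPhi q * eulerPhi (q ^ m)))) := by
  refine ⟨⟨fun k => (gaussExponent m k).toNat, fun k => Int.toNat_of_nonneg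
    (gaussExponent_nonneg hm k), ?_⟩, fun q hq => hasSum_gaussExponent hm hq⟩
  have hpow : ∀ (q : ℂ) (k : Fin (4 * m - 1) → ℤ),
      q ^ (gaussExponent m k).toNat = q ^ gaussExponent m k := fun q k => by
    rw [← zpow_natCast, Int.toNat_of_nonneg (gaussExponent_nonneg hm k)]
  have hfin := finite_fiber_of_summable (e := fun k => (gaussExponent m k).toNat) (by
    simp only [hpow]
    exact (hasSum_gaussExponent hm (q := 1 / 2) (by norm_num)).summable)
  obtain ⟨P, hP⟩ := summable_X_pow hfin
  have hPeval : ∀ q : ℂ, ‖q‖ < 1 → HasEval P q (eulerPhi (q ^ (4 * m - 1)) ^ (4 * m - 1) *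
      eulerPhi (q ^ (2 * m)) ^ 2 / (eulerPhi q * eulerPhi (q ^ m))) := by
    intro q hq
    refine HasEval.of_hasSum (c := fun _ => 1) (e := fun k => (gaussExponent m k).toNat) ?_ ?_
    · simpa only [PowerSeries.X_pow_eq] using hP
    · simpa only [one_mul, hpow] using hasSum_gaussExponent hm hq
  have hphi : ∀ q : ℂ, ‖q‖ < 1 →
      HasEval (eulerPhi (PowerSeries.X : PowerSeries ℂ)) q (eulerPhi q) := fun q hq => by
    simpa only [pow_one] using hasEval_eulerPhi one_pos hq
  have hD : ∀ q : ℂ, ‖q‖ < 1 → HasEval (eulerPhi (PowerSeries.X : PowerSeries ℂ) *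
      eulerPhi ((PowerSeries.X : PowerSeries ℂ) ^ m)) q (eulerPhi q * eulerPhi (q ^ m)) :=
    fun q hq => (hphi q hq).mul (hasEval_eulerPhi hm hq)
  have hD0 : PowerSeries.constantCoeff (eulerPhi (PowerSeries.X : PowerSeries ℂ) *
      eulerPhi ((PowerSeries.X : PowerSeries ℂ) ^ m)) ≠ 0 := by
    rw [(hD 0 (by simp)).constantCoeff_eq, zero_pow hm.ne', eulerPhi_zero]
    simp
  -- The denominator is cleared so that only products need evaluating; its constant coefficient,
  -- read off at `q = 0`, is nonzero, so it can be inverted afterwards.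
  have hmul : P * (eulerPhi (PowerSeries.X : PowerSeries ℂ) *
      eulerPhi ((PowerSeries.X : PowerSeries ℂ) ^ m)) =
      eulerPhi ((PowerSeries.X : PowerSeries ℂ) ^ (4 * m - 1)) ^ (4 * m - 1) *
        eulerPhi ((PowerSeries.X : PowerSeries ℂ) ^ (2 * m)) ^ 2 := by
    refine eq_of_hasEval (fun q hq => (hPeval q hq).mul (hD q hq)) fun q hq => ?_
    rw [div_mul_cancel₀ _ (mul_ne_zero (eulerPhi_ne_zero hq)
      (eulerPhi_ne_zero (norm_pow_lt_one hq hm.ne')))]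
    exact ((hasEval_eulerPhi (by omega) hq).pow _).mul ((hasEval_eulerPhi (by omega) hq).pow _)
  rwa [← hmul, mul_assoc, PowerSeries.mul_inv_cancel _ hD0, mul_one]
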